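/- Let $f:\mathbb{R}_+=[0,\infty)\to\mathbb{C}$ be Lipschitz with $f(0)=0$, and put $$\|f\|_{\mathrm{Lip}\text{-}\mathbb{C}}=\sup\left\{\frac{|f(x)-cf(y)|}{|x-cy|}\;:\;x,y\ge 0,\ c\in\mathbb{C},\ |c|=1,\ x\ne cy\right\}.$$ Let $\mathcal{H}$ be a separable complex Hilbert space of dimension $d$, $1\le d\le\infty$. For a compact operator $A$ on $\mathcal{H}$ with singular value decomposition $Ah=\sum_n s_n\langle h,v_n\rangle u_n$ (where $(u_n)$, $(v_n)$ are orthonormal systems and $s_n\ge 0$), let $f_s(A)$ be the operator $f_s(A)h=\sum_n f(s_n)\langle h,v_n\rangle u_n$. Let $\mathcal{S}_2$ be the class of Hilbert–Schmidt operators on $\mathcal{H}$, with norm $\|A\|_{\mathcal{S}_2}=(\sum_n s_n^2)^{1/2}$. Then $\|f\|_{\mathrm{Lip}\text{-}\mathbb{C}}<\infty$, the operator $f_s(A)$ is a well-defined bounded operator for every compact $A$, and for all $A,B\in\mathcal{S}_2$ $$\|f_s(A)-f_s(B)\|_{\mathcal{S}_2}\le\|f\|_{\mathrm{Lip}\text{-}\mathbb{C}}\,\|A-B\|_{\mathcal{S}_2}.$$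 This estimate is optimal: on every such $\mathcal{H}$, any constant $C\in[0,\infty]$ with $\|f_s(A)-f_s(B)\|_{\mathcal{S}_2}\le C\|A-B\|_{\mathcal{S}_2}$ for all $A,B\in\mathcal{S}_2$ satisfies $C\ge\|f\|_{\mathrm{Lip}\text{-}\mathbb{C}}$. In other words, $$\|f_s\|_{\mathrm{Lip}}:=\sup_{A,B\in\mathcal{S}_2,\ A\ne B}\frac{\|f_s(A)-f_s(B)\|_{\mathcal{S}_2}}{\|A-B\|_{\mathcal{S}_2}}=\|f\|_{\mathrm{Lip}\text{-}\mathbb{C}},$$ independently of the dimension of $\mathcal{H}$. Likewise, for every $d\ge1$, the supremum of $\|f_s(A)-f_s(B)\|_F/\|A-B\|_F$ over distinct complex $d\times d$ matrices $A,B$, with $\|\cdot\|_F$ the Frobenius norm, equals $\|f\|_{\mathrm{Lip}\text{-}\mathbb{C}}$. -/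

import Mathlib

open scoped NNReal ENNReal InnerProductSpace

universe u v w

namespace SingularCalculus

section Operators

variable {H : Type u} [NormedAddCommGroup H] [InnerProductSpace ℂ H]

/-- Singular value decomposition `A = ∑ᵢ sᵢ uᵢ ⊗ vᵢ`, that is `A h = ∑ᵢ sᵢ ⟨h, vᵢ⟩ uᵢ` for every `h`,
with `u`, `v` orthonormal systems and `sᵢ ≥ 0`. (Mathlib's inner product is linear in the second
variable, so `⟨h, vᵢ⟩` is written `⟪v i, h⟫_ℂ`. Some of the `sᵢ` may vanish.) -/
structure IsSVD {ι : Type v} (A : H →L[ℂ] H) (s : ι → ℝ≥0) (u v : ι → H) : Prop where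
  left_orthonormal : Orthonormal ℂ u
  right_orthonormal : Orthonormal ℂ v
  hasSum : ∀ h : H, HasSum (fun i => (((s i : ℝ) : ℂ) * ⟪v i, h⟫_ℂ) • u i) (A h)

/-- `T = ∑ᵢ f(sᵢ) uᵢ ⊗ vᵢ` for some singular value decomposition `A = ∑ᵢ sᵢ uᵢ ⊗ vᵢ`. -/
def IsSingularCalculus (f : ℝ≥0 → ℂ) (A T : H →L[ℂ] H) : Prop :=
  ∃ (ι : Type u) (s : ι → ℝ≥0) (u v : ι → H), IsSVD A s u v ∧
    ∀ h : H, HasSum (fun i => (f (s i) * ⟪v i, h⟫_ℂ) • u i) (T h)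

open Classical in
/-- The singular value functional calculus `f_s(A) = ∑ᵢ f(sᵢ) uᵢ ⊗ vᵢ`. For `f 0 = 0` the value does
not depend on the decomposition, see `IsSingularCalculus.unique`. It is set to `0` if `A` has no
singular value decomposition for which the series defines a bounded operator. -/
noncomputable def singularCalculus (f : ℝ≥0 → ℂ) (A : H →L[ℂ] H) : H →L[ℂ] H :=
  if h : ∃ T : H →L[ℂ] H, IsSingularCalculus f A T then h.choose else 0

theorem IsSVD.apply_right {ι : Type v} {A : H →L[ℂ] H} {s : ι → ℝ≥0} {u v : ι → H}
    (hA : IsSVD A s u v) (i : ι) : A (v i) = ((s i : ℝ) : ℂ) • u i := by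
  classical
  have h1 := hA.hasSum (v i)
  have h2 : HasSum (fun j => (((s j : ℝ) : ℂ) * ⟪v j, v i⟫_ℂ) • u j)
      ((((s i : ℝ) : ℂ) * ⟪v i, v i⟫_ℂ) • u i) := by
    apply hasSum_single
    intro j hj
    rw [hA.right_orthonormal.2 hj]
    simp
  rw [h1.unique h2]
  simp [hA.right_orthonormal.1 i]

theorem IsSVD.inner_left {ι : Type v} {A : H →L[ℂ] H} {s : ι → ℝ≥0} {u v : ι → H}
    (hA : IsSVD A s u v) (i : ι) (h : H) : ⟪u i, A h⟫_ℂ = ((s i : ℝ) : ℂ) * ⟪v i, h⟫_ℂ := by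
  classical
  have h1 := (innerSL ℂ (u i)).hasSum (hA.hasSum h)
  have h2 : HasSum (fun j => innerSL ℂ (u i) ((((s j : ℝ) : ℂ) * ⟪v j, h⟫_ℂ) • u j))
      (innerSL ℂ (u i) ((((s i : ℝ) : ℂ) * ⟪v i, h⟫_ℂ) • u i)) := by
    apply hasSum_single
    intro j hj
    simp [hA.left_orthonormal.2 hj.symm]
  have h3 := h1.unique h2
  simpa [inner_smul_right, hA.left_orthonormal.1 i] using h3

/-- Two singular value decompositions of the same operator: `⟨vᵢ, v'ⱼ⟩ ≠ 0` forces `sᵢ = s'ⱼ`. -/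
theorem IsSVD.eq_of_inner_ne_zero [CompleteSpace H] {ι : Type v} {κ : Type w} {A : H →L[ℂ] H}
    {s : ι → ℝ≥0} {u v : ι → H} {s' : κ → ℝ≥0} {u' v' : κ → H}
    (hA : IsSVD A s u v) (hA' : IsSVD A s' u' v') (i : ι) (j : κ) (hij : ⟪v i, v' j⟫_ℂ ≠ 0) :
    s i = s' j := by
  have e1 : ((s i : ℝ) : ℂ) * ⟪v i, v' j⟫_ℂ = ((s' j : ℝ) : ℂ) * ⟪u i, u' j⟫_ℂ := by
    rw [← hA.inner_left, hA'.apply_right, inner_smul_right]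
  have e2 : ((s' j : ℝ) : ℂ) * ⟪v' j, v i⟫_ℂ = ((s i : ℝ) : ℂ) * ⟪u' j, u i⟫_ℂ := by
    rw [← hA'.inner_left, hA.apply_right, inner_smul_right]
  have e3 : ((s' j : ℝ) : ℂ) * ⟪v i, v' j⟫_ℂ = ((s i : ℝ) : ℂ) * ⟪u i, u' j⟫_ℂ := by
    have := congrArg (starRingEnd ℂ) e2
    simpa using this
  have e4 : (((s i : ℝ) : ℂ) ^ 2 - ((s' j : ℝ) : ℂ) ^ 2) * ⟪v i, v' j⟫_ℂ = 0 := by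
    linear_combination ((s i : ℝ) : ℂ) * e1 - ((s' j : ℝ) : ℂ) * e3
  have e5 := (mul_eq_zero.mp e4).resolve_right hij
  have e6 : (s i : ℝ) ^ 2 = (s' j : ℝ) ^ 2 := by
    have := sub_eq_zero.mp e5
    exact_mod_cast this
  have e7 : (s i : ℝ) = (s' j : ℝ) :=
    (pow_left_inj₀ (s i).coe_nonneg (s' j).coe_nonneg two_ne_zero).mp e6
  exact_mod_cast e7

/-- The operator `∑ᵢ f(sᵢ) uᵢ ⊗ vᵢ` does not depend on the singular value decomposition. -/
theorem IsSVD.calculus_unique [CompleteSpace H] {f : ℝ≥0 → ℂ} (hf0 : f 0 = 0)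
    {ι : Type v} {κ : Type w} {A T T' : H →L[ℂ] H}
    {s : ι → ℝ≥0} {u v : ι → H} {s' : κ → ℝ≥0} {u' v' : κ → H}
    (hA : IsSVD A s u v) (hA' : IsSVD A s' u' v')
    (hT : ∀ h : H, HasSum (fun i => (f (s i) * ⟪v i, h⟫_ℂ) • u i) (T h))
    (hT' : ∀ h : H, HasSum (fun j => (f (s' j) * ⟪v' j, h⟫_ℂ) • u' j) (T' h)) : T = T' := by
  classical
  -- the two operators agree on the vectors `v' j`
  have key : ∀ j, T (v' j) = T' (v' j) := by
    intro j
    have hT'j : T' (v' j) = f (s' j) • u' j := by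
      refine (hT' (v' j)).unique ?_
      have : HasSum (fun k => (f (s' k) * ⟪v' k, v' j⟫_ℂ) • u' k)
          ((f (s' j) * ⟪v' j, v' j⟫_ℂ) • u' j) := by
        apply hasSum_single
        intro k hk
        rw [hA'.right_orthonormal.2 hk]
        simp
      simpa [hA'.right_orthonormal.1 j] using this
    rw [hT'j]
    refine (hT (v' j)).unique ?_
    by_cases hs : s' j = 0
    · have hz : ∀ i, (f (s i) * ⟪v i, v' j⟫_ℂ) • u i = 0 := by
        intro i
        by_cases hij : ⟪v i, v' j⟫_ℂ = 0
        · simp [hij]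
        · simp [hA.eq_of_inner_ne_zero hA' i j hij, hs, hf0]
      simp only [hz, hs, hf0, zero_smul]
      exact hasSum_zero
    · have hs' : ((s' j : ℝ) : ℂ) ≠ 0 := by exact_mod_cast hs
      have h1 := (hA.hasSum (v' j)).const_smul (f (s' j) / ((s' j : ℝ) : ℂ))
      rw [hA'.apply_right, smul_smul, div_mul_cancel₀ _ hs'] at h1
      refine h1.congr_fun ?_
      intro i
      by_cases hij : ⟪v i, v' j⟫_ℂ = 0
      · simp [hij]
      · rw [hA.eq_of_inner_ne_zero hA' i j hij, smul_smul]
        congr 1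
        field_simp
  -- both vanish on the orthogonal complement of the `v' j`
  let K : Submodule ℂ H := (Submodule.span ℂ (Set.range v')).topologicalClosure
  have hK : ∀ x ∈ K, T x = T' x := by
    have hle : K ≤ LinearMap.ker ((T - T' : H →L[ℂ] H) : H →ₗ[ℂ] H) := by
      refine Submodule.topologicalClosure_minimal _ ?_ (T - T').isClosed_ker
      rw [Submodule.span_le]
      rintro _ ⟨j, rfl⟩
      simp [key j]
    intro x hx
    have := hle hx
    simpa [sub_eq_zero] using this
  have hKo : ∀ x ∈ Kᗮ, T x = T' x := by
    intro x hx
    have hx' : ∀ j, ⟪v' j, x⟫_ℂ = 0 := fun j =>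
      hx _ (Submodule.le_topologicalClosure _ (Submodule.subset_span ⟨j, rfl⟩))
    have hT'x : T' x = 0 := (hT' x).unique (by simp [hx'])
    have hAx : A x = 0 := (hA'.hasSum x).unique (by simp [hx'])
    have hTx : T x = 0 := by
      refine (hT x).unique ?_
      have hz : ∀ i, (f (s i) * ⟪v i, x⟫_ℂ) • u i = 0 := by
        intro i
        have h1 := hA.inner_left i x
        rw [hAx, inner_zero_right] at h1
        rcases mul_eq_zero.mp h1.symm with h2 | h2
        · have : s i = 0 := by exact_mod_cast h2
          simp [this, hf0]
        · simp [h2]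
      simp only [hz]
      exact hasSum_zero
    rw [hTx, hT'x]
  ext x
  have : CompleteSpace K := (Submodule.isClosed_topologicalClosure _).completeSpace_coe
  obtain ⟨y, hy, z, hz, rfl⟩ := K.exists_add_mem_mem_orthogonal x
  rw [map_add, map_add, hK y hy, hKo z hz]

theorem IsSingularCalculus.unique [CompleteSpace H] {f : ℝ≥0 → ℂ} (hf0 : f 0 = 0)
    {A T T' : H →L[ℂ] H} (hT : IsSingularCalculus f A T) (hT' : IsSingularCalculus f A T') :
    T = T' := by
  obtain ⟨ι, s, u, v, hA, h⟩ := hT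
  obtain ⟨κ, s', u', v', hA', h'⟩ := hT'
  exact hA.calculus_unique hf0 hA' h h'

theorem IsSingularCalculus.eq_singularCalculus [CompleteSpace H] {f : ℝ≥0 → ℂ} (hf0 : f 0 = 0)
    {A T : H →L[ℂ] H} (hT : IsSingularCalculus f A T) : singularCalculus f A = T := by
  have h : ∃ T : H →L[ℂ] H, IsSingularCalculus f A T := ⟨T, hT⟩
  rw [singularCalculus, dif_pos h]
  exact h.choose_spec.unique hf0 hT

theorem enorm_sq_of_hasSum {ι : Type v} {u : ι → H} (hu : Orthonormal ℂ u) {c : ι → ℂ} {x : H}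
    (h : HasSum (fun i => c i • u i) x) : ‖x‖ₑ ^ 2 = ∑' i, ‖c i‖ₑ ^ 2 := by
  classical
  have hin : ∀ i, ⟪u i, x⟫_ℂ = c i := by
    intro i
    have h1 := (innerSL ℂ (u i)).hasSum h
    have h2 : HasSum (fun j => innerSL ℂ (u i) (c j • u j)) (innerSL ℂ (u i) (c i • u i)) := by
      apply hasSum_single
      intro j hj
      simp [hu.2 hj.symm]
    have h3 := h1.unique h2
    simpa [inner_smul_right, hu.1 i] using h3
  have h4 := (innerSL ℂ x).hasSum h
  have h5 : HasSum (fun i => ‖c i‖ ^ 2) (‖x‖ ^ 2) := by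
    rw [← Complex.hasSum_ofReal]
    have h6 : ∀ i, innerSL ℂ x (c i • u i) = ((‖c i‖ ^ 2 : ℝ) : ℂ) := by
      intro i
      rw [innerSL_apply_apply, inner_smul_right, ← inner_conj_symm, hin i, Complex.mul_conj,
        Complex.normSq_eq_norm_sq]
    have h7 : innerSL ℂ x x = ((‖x‖ ^ 2 : ℝ) : ℂ) := by
      rw [innerSL_apply_apply, inner_self_eq_norm_sq_to_K]
      norm_cast
    have h8 : HasSum (fun i => innerSL ℂ x (c i • u i)) (innerSL ℂ x x) := h4
    rw [h7] at h8
    simpa only [h6] using h8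
  have h10 : ENNReal.ofReal (‖x‖ ^ 2) = ∑' i, ENNReal.ofReal (‖c i‖ ^ 2) := by
    rw [← h5.tsum_eq]
    exact ENNReal.ofReal_tsum_of_nonneg (fun i => by positivity) h5.summable
  simpa [ENNReal.ofReal_pow] using h10

theorem enorm_inner_symm (x y : H) : ‖⟪x, y⟫_ℂ‖ₑ = ‖⟪y, x⟫_ℂ‖ₑ := by
  rw [← ofReal_norm, ← ofReal_norm, norm_inner_symm]

variable [CompleteSpace H]

/-- The Hilbert–Schmidt norm `(∑ₙ ‖A eₙ‖²)^(1/2) ∈ [0, ∞]`, for an orthonormal basis `(eₙ)` of `H`.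
It does not depend on the basis (`hsENorm_eq`), and it equals `(∑ᵢ sᵢ²)^(1/2)` for the singular values
`sᵢ` of `A` (`IsSVD.hsENorm_eq`). -/
noncomputable def hsENorm (A : H →L[ℂ] H) : ℝ≥0∞ :=
  (∑' e : (exists_hilbertBasis ℂ H).choose,
    ‖A ((exists_hilbertBasis ℂ H).choose_spec.choose e)‖ₑ ^ 2) ^ (1 / 2 : ℝ)

theorem enorm_sq_eq_tsum_inner {ι : Type v} (b : HilbertBasis ι ℂ H) (x : H) :
    ‖x‖ₑ ^ 2 = ∑' i, ‖⟪b i, x⟫_ℂ‖ₑ ^ 2 := by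
  have h := b.hasSum_repr x
  simp only [HilbertBasis.repr_apply_apply] at h
  exact enorm_sq_of_hasSum b.orthonormal h

theorem tsum_enorm_sq_adjoint {ι : Type v} {κ : Type w} (b : HilbertBasis ι ℂ H)
    (c : HilbertBasis κ ℂ H) (A : H →L[ℂ] H) :
    ∑' i, ‖A (b i)‖ₑ ^ 2 = ∑' j, ‖ContinuousLinearMap.adjoint A (c j)‖ₑ ^ 2 := by
  simp_rw [enorm_sq_eq_tsum_inner c (A _), enorm_sq_eq_tsum_inner b (ContinuousLinearMap.adjoint A _),
    ContinuousLinearMap.adjoint_inner_right]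
  rw [ENNReal.tsum_comm]
  simp_rw [enorm_inner_symm (A _)]

theorem hsENorm_eq {ι : Type v} (b : HilbertBasis ι ℂ H) (A : H →L[ℂ] H) :
    hsENorm A = (∑' i, ‖A (b i)‖ₑ ^ 2) ^ (1 / 2 : ℝ) := by
  rw [hsENorm, tsum_enorm_sq_adjoint _ b, tsum_enorm_sq_adjoint b b,
    ContinuousLinearMap.adjoint_adjoint]

theorem IsSVD.hsENorm_eq {ι : Type v} {A : H →L[ℂ] H} {s : ι → ℝ≥0} {u v : ι → H}
    (hA : IsSVD A s u v) : hsENorm A = (∑' i, (s i : ℝ≥0∞) ^ 2) ^ (1 / 2 : ℝ) := by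
  obtain ⟨w, b, -⟩ := exists_hilbertBasis ℂ H
  rw [SingularCalculus.hsENorm_eq b]
  congr 1
  simp_rw [enorm_sq_of_hasSum hA.left_orthonormal (hA.hasSum _)]
  rw [ENNReal.tsum_comm]
  refine tsum_congr fun i => ?_
  have hs : ‖((s i : ℝ) : ℂ)‖ₑ = (s i : ℝ≥0∞) := by
    rw [enorm_eq_nnnorm]; simp
  simp_rw [enorm_mul, mul_pow, hs, enorm_inner_symm (v i)]
  rw [ENNReal.tsum_mul_left, ← enorm_sq_eq_tsum_inner b, ← ofReal_norm,
    hA.right_orthonormal.1 i]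
  simp

/-- The Hilbert–Schmidt class `𝒮₂`. -/
def IsHilbertSchmidt (A : H →L[ℂ] H) : Prop :=
  IsCompactOperator A ∧ hsENorm A < ⊤

variable (H) in
/-- `‖f_s‖_Lip`, the supremum of `‖f_s(A) - f_s(B)‖_{𝒮₂} / ‖A - B‖_{𝒮₂}` over distinct `A, B ∈ 𝒮₂`. -/
noncomputable def operatorLip (f : ℝ≥0 → ℂ) : ℝ≥0∞ :=
  ⨆ (A : H →L[ℂ] H) (B : H →L[ℂ] H) (_ : IsHilbertSchmidt A) (_ : IsHilbertSchmidt B) (_ : A ≠ B),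
    hsENorm (singularCalculus f A - singularCalculus f B) / hsENorm (A - B)

end Operators

/-- `‖f‖_{Lip-ℂ}`, the supremum of `|f(x) - c f(y)| / |x - c y|` over `x, y ≥ 0` and unimodular `c`
with `x ≠ c y`. -/
noncomputable def lipC (f : ℝ≥0 → ℂ) : ℝ≥0∞ :=
  ⨆ (x : ℝ≥0) (y : ℝ≥0) (c : Circle) (_ : ((x : ℝ) : ℂ) ≠ (c : ℂ) * ((y : ℝ) : ℂ)),
    ‖f x - (c : ℂ) * f y‖ₑ / ‖((x : ℝ) : ℂ) - (c : ℂ) * ((y : ℝ) : ℂ)‖ₑ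

section Matrices

open scoped Matrix.Norms.Frobenius

/-- The singular value functional calculus of a `d × d` matrix, as an operator on `ℂᵈ`. -/
noncomputable def matrixCalculus {d : ℕ} (f : ℝ≥0 → ℂ) (A : Matrix (Fin d) (Fin d) ℂ) :
    Matrix (Fin d) (Fin d) ℂ :=
  (Matrix.toEuclideanCLM (n := Fin d) (𝕜 := ℂ)).symm
    (singularCalculus f (Matrix.toEuclideanCLM (n := Fin d) (𝕜 := ℂ) A))

/-- `‖f_s‖_Lip` for `d × d` matrices, the supremum of `‖f_s(A) - f_s(B)‖_F / ‖A - B‖_F` over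
distinct `A, B`, in the Frobenius norm. -/
noncomputable def matrixLip (d : ℕ) (f : ℝ≥0 → ℂ) : ℝ≥0∞ :=
  ⨆ (A : Matrix (Fin d) (Fin d) ℂ) (B : Matrix (Fin d) (Fin d) ℂ) (_ : A ≠ B),
    ‖matrixCalculus f A - matrixCalculus f B‖ₑ / ‖A - B‖ₑ

end Matrices

end SingularCalculus

/-!
Write `A = ∑ᵢ sᵢ uᵢ ⊗ vᵢ` and `B = ∑ⱼ tⱼ wⱼ ⊗ zⱼ`, and put `γᵢⱼ = ⟨uᵢ, wⱼ⟩ ⟨zⱼ, vᵢ⟩`. Computing in a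
Hilbert basis that extends the `vᵢ` gives (`hsENorm_sub_eq`)
`‖f_s(A) - f_s(B)‖² = ∑ᵢ |f(sᵢ)|² + ∑ⱼ |f(tⱼ)|² - 2 Re ∑ᵢⱼ conj(f(sᵢ)) f(tⱼ) γᵢⱼ`,
and the same formula with `f` replaced by the identity gives `‖A - B‖²`.

The overlaps satisfy `|γᵢⱼ| ≤ pᵢⱼ` with `pᵢⱼ = (|⟨uᵢ, wⱼ⟩|² + |⟨vᵢ, zⱼ⟩|²) / 2`, and by Bessel's
inequality `p` has row and column sums at most `1`. With `L = ‖f‖_{Lip-ℂ}`, expanding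
`|f(s) - c f(t)|² ≤ L² |s - c t|²` and optimising over the unimodular `c` bounds
`2 |L² s t - conj(f(s)) f(t)|` by the sum of the nonnegative defects `L² s² - |f(s)|²` and
`L² t² - |f(t)|²` (`two_mul_norm_cross_le`). Weighting by `p` and summing bounds the difference of
the cross terms by the sum of all defects, which is the claimed estimate (`sq_expansion_le`). The
orthonormal systems need not be complete: a deficit in the row or column sums of `p` only helps,
because the defects are nonnegative.

The calculus is defined on every compact `A`: a Hilbert basis of eigenvectors of `A* A` is mapped by
`A` to pairwise orthogonal vectors, whose normalisations are the `uᵢ` (`exists_isSVD`), and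
`|f(s)| ≤ L s` keeps the coefficients bounded (`exists_isSingularCalculus`).

For sharpness, take a unit vector `e` and compare `x (e ⊗ e)` with `c y (e ⊗ e)`: the operator
quotient is exactly the scalar quotient `|f(x) - c f(y)| / |x - c y|` (`lipC_le_operatorLip`).
Matrices are the case of the Hilbert space `ℂᵈ`, whose Hilbert–Schmidt norm is the Frobenius norm.
-/

namespace SingularCalculus

/-! ### Existence of singular value decompositions and of the calculus -/

section Existence

variable {H : Type u} [NormedAddCommGroup H] [InnerProductSpace ℂ H]

theorem hasSum_norm_sq_of_hasSum {ι : Type v} {u : ι → H} (hu : Orthonormal ℂ u) {c : ι → ℂ} {x : H}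
    (h : HasSum (fun i => c i • u i) x) : HasSum (fun i => ‖c i‖ ^ 2) (‖x‖ ^ 2) := by
  have h1 := h.norm.pow 2
  refine h1.congr fun s => ?_
  have h2 := hu.inner_sum c c s
  have h3 : ((‖∑ i ∈ s, c i • u i‖ ^ 2 : ℝ) : ℂ) = ((∑ i ∈ s, ‖c i‖ ^ 2 : ℝ) : ℂ) := by
    rw [inner_self_eq_norm_sq_to_K] at h2
    push_cast
    simpa [Complex.conj_mul'] using h2
  exact_mod_cast h3

/-- An operator that maps some Hilbert basis to pairwise orthogonal vectors has a singular value
decomposition: normalise the nonzero images. -/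
theorem exists_isSVD_of_orthogonal {κ : Type u} (b : HilbertBasis κ ℂ H) (A : H →L[ℂ] H)
    (hA : Pairwise fun i j => ⟪A (b i), A (b j)⟫_ℂ = 0) :
    ∃ (ι : Type u) (s : ι → ℝ≥0) (u v : ι → H), IsSVD A s u v := by
  refine ⟨{i : κ // A (b i) ≠ 0}, fun i => ‖A (b i)‖₊,
    fun i => ((‖A (b i)‖ : ℂ))⁻¹ • A (b i), fun i => b i, ⟨fun i => ?_, fun i j hij => ?_⟩,
    b.orthonormal.comp _ Subtype.val_injective, fun h => ?_⟩
  · have := i.2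
    simp [norm_smul, this]
  · simp [inner_smul_left, inner_smul_right, hA (fun h => hij (Subtype.ext h))]
  · have h1 := (b.hasSum_repr h).mapL A
    simp only [HilbertBasis.repr_apply_apply, map_smul] at h1
    have h2 := (Subtype.val_injective (p := fun i => A (b i) ≠ 0)).hasSum_iff
      (f := fun i => ⟪b i, h⟫_ℂ • A (b i)) (a := A h) (fun i hi => by
        have : A (b i) = 0 := by simpa using hi
        simp [this])
    refine (h2.2 h1).congr_fun fun i => ?_
    have hi : (‖A (b i)‖ : ℂ) ≠ 0 := by
      simpa using i.2
    simp only [Function.comp_apply, coe_nnnorm, smul_smul]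
    congr 1
    field_simp

theorem isSingularCalculus_singularCalculus {f : ℝ≥0 → ℂ} {A : H →L[ℂ] H}
    (h : ∃ T, IsSingularCalculus f A T) : IsSingularCalculus f A (singularCalculus f A) := by
  rw [singularCalculus, dif_pos h]
  exact h.choose_spec

variable [CompleteSpace H]

theorem summable_smul_of_orthonormal {ι : Type v} {u : ι → H} (hu : Orthonormal ℂ u) {c : ι → ℂ}
    (h : Summable fun i => ‖c i‖ ^ 2) : Summable fun i => c i • u i := by
  simpa using (hu.orthogonalFamily.summable_iff_norm_sq_summable c).2 h

/-- Bounded coefficients and two orthonormal systems define a bounded operator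
`∑ᵢ cᵢ uᵢ ⊗ vᵢ`. -/
theorem exists_clm_hasSum {ι : Type v} {u v : ι → H} (hu : Orthonormal ℂ u) (hv : Orthonormal ℂ v)
    {c : ι → ℂ} {M : ℝ} (hM : ∀ i, ‖c i‖ ≤ M) :
    ∃ T : H →L[ℂ] H, ∀ h, HasSum (fun i => (c i * ⟪v i, h⟫_ℂ) • u i) (T h) := by
  have hle : ∀ h i, ‖c i * ⟪v i, h⟫_ℂ‖ ^ 2 ≤ M ^ 2 * ‖⟪v i, h⟫_ℂ‖ ^ 2 := fun h i => by
    rw [norm_mul, mul_pow]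
    gcongr
    exact hM i
  have hs : ∀ h, Summable fun i => M ^ 2 * ‖⟪v i, h⟫_ℂ‖ ^ 2 := fun h =>
    (hv.inner_products_summable (x := h)).mul_left _
  have hsum : ∀ h, Summable fun i => (c i * ⟪v i, h⟫_ℂ) • u i := fun h =>
    summable_smul_of_orthonormal hu
      (Summable.of_nonneg_of_le (fun i => by positivity) (hle h) (hs h))
  let T₀ : H →ₗ[ℂ] H :=
    { toFun := fun h => ∑' i, (c i * ⟪v i, h⟫_ℂ) • u i
      map_add' := fun x y => by
        rw [← (hsum x).tsum_add (hsum y)]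
        simp only [inner_add_right, mul_add, add_smul]
      map_smul' := fun a x => by
        rw [RingHom.id_apply, ← (hsum x).tsum_const_smul]
        simp only [inner_smul_right, smul_smul, mul_left_comm] }
  refine ⟨T₀.mkContinuous |M| fun h => ?_, fun h => (hsum h).hasSum⟩
  refine abs_le_of_sq_le_sq' ?_ (by positivity) |>.2
  have h1 := hasSum_norm_sq_of_hasSum hu (hsum h).hasSum
  rw [mul_pow, sq_abs]
  calc ‖T₀ h‖ ^ 2 ≤ ∑' i, M ^ 2 * ‖⟪v i, h⟫_ℂ‖ ^ 2 := hasSum_le (hle h) h1 (hs h).hasSum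
    _ ≤ M ^ 2 * ‖h‖ ^ 2 := by
      rw [tsum_mul_left]
      gcongr
      exact hv.tsum_inner_products_le h

/-- A compact symmetric operator has a Hilbert basis of eigenvectors. -/
theorem exists_eigenbasis {T : H →L[ℂ] H} (hT : IsCompactOperator T)
    (hT' : (T : H →ₗ[ℂ] H).IsSymmetric) :
    ∃ (κ : Type u) (b : HilbertBasis κ ℂ H) (μ : κ → ℂ), ∀ i, T (b i) = μ i • b i := by
  let E : ℂ → Submodule ℂ H := fun μ => Module.End.eigenspace (T : H →ₗ[ℂ] H) μ
  have hE : ∀ μ, CompleteSpace (E μ) := fun μ => by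
    have : IsClosed (E μ : Set H) := by
      have : E μ = LinearMap.ker ((T - μ • ContinuousLinearMap.id ℂ H : H →L[ℂ] H) : H →ₗ[ℂ] H) := by
        ext x
        simp [E, sub_eq_zero]
      rw [this]
      exact ContinuousLinearMap.isClosed_ker _
    exact this.completeSpace_coe
  choose w b hb using fun μ => exists_hilbertBasis ℂ (E μ)
  have horth : Orthonormal ℂ (fun a : Σ μ, w μ => ((b a.1 a.2 : E a.1) : H)) :=
    hT'.orthogonalFamily_eigenspaces.orthonormal_sigma_orthonormal (fun μ => (b μ).orthonormal)
  have hbot : (Submodule.span ℂ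
      (Set.range fun a : Σ μ, w μ => ((b a.1 a.2 : E a.1) : H)))ᗮ = ⊥ := by
    rw [eq_bot_iff, ← ContinuousLinearMap.orthogonalComplement_iSup_eigenspaces_eq_bot hT hT']
    intro x hx
    rw [← Submodule.iInf_orthogonal, Submodule.mem_iInf]
    intro μ y hy
    have h1 := ((b μ).hasSum_repr ⟨y, hy⟩).mapL ((innerSL ℂ x).comp (E μ).subtypeL)
    have h2 : ∀ i, ⟪x, ((b μ i : E μ) : H)⟫_ℂ = 0 := fun i => by
      rw [inner_eq_zero_symm]
      exact hx _ (Submodule.subset_span ⟨⟨μ, i⟩, rfl⟩)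
    rw [inner_eq_zero_symm]
    refine h1.unique ?_
    simp [h2]
  refine ⟨_, HilbertBasis.mkOfOrthogonalEqBot horth hbot, fun a => a.1, fun a => ?_⟩
  rw [HilbertBasis.coe_mkOfOrthogonalEqBot]
  exact Module.End.mem_eigenspace_iff.1 (b a.1 a.2).2

/-- Singular value decomposition of a compact operator, from an eigenbasis of `A* A`: if
`A* A bⱼ = μⱼ bⱼ`, then `⟨A bᵢ, A bⱼ⟩ = μⱼ ⟨bᵢ, bⱼ⟩`. -/
theorem exists_isSVD {A : H →L[ℂ] H} (hA : IsCompactOperator A) :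
    ∃ (ι : Type u) (s : ι → ℝ≥0) (u v : ι → H), IsSVD A s u v := by
  have hc : IsCompactOperator (ContinuousLinearMap.adjoint A ∘L A) :=
    hA.clm_comp (ContinuousLinearMap.adjoint A)
  have hs : ((ContinuousLinearMap.adjoint A ∘L A : H →L[ℂ] H) : H →ₗ[ℂ] H).IsSymmetric :=
    fun x y => by
      simp [ContinuousLinearMap.adjoint_inner_left, ContinuousLinearMap.adjoint_inner_right]
  obtain ⟨κ, b, μ, hb⟩ := exists_eigenbasis hc hs
  refine exists_isSVD_of_orthogonal b A fun i j hij => ?_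
  beta_reduce
  rw [← ContinuousLinearMap.adjoint_inner_right]
  have := hb j
  rw [ContinuousLinearMap.comp_apply] at this
  rw [this, inner_smul_right, b.orthonormal.2 hij, mul_zero]

/-- The singular values of `A` are at most `‖A‖`, so a function of linear growth gives bounded
coefficients. -/
theorem exists_isSingularCalculus {f : ℝ≥0 → ℂ} {K : ℝ≥0} (hf : ∀ x, ‖f x‖ ≤ K * x)
    {A : H →L[ℂ] H} (hA : IsCompactOperator A) : ∃ T, IsSingularCalculus f A T := by
  obtain ⟨ι, s, u, v, h⟩ := exists_isSVD hA
  have hs : ∀ i, ‖f (s i)‖ ≤ K * ‖A‖ := fun i => by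
    refine (hf _).trans ?_
    gcongr
    have h1 := A.le_opNorm (v i)
    rw [h.apply_right, norm_smul, h.left_orthonormal.1, h.right_orthonormal.1] at h1
    simpa using h1
  obtain ⟨T, hT⟩ := exists_clm_hasSum h.left_orthonormal h.right_orthonormal hs
  exact ⟨T, ι, s, u, v, h, hT⟩

end Existence

/-! ### Substochastic weights and the scalar inequality -/

section Numerical

variable {ι : Type v} {κ : Type w}

/-- Pairing two summable families with a weight whose row and column sums are at most `1`. -/
theorem sum_substochastic_le {D : ι → ℝ} {E : κ → ℝ} (hD0 : ∀ i, 0 ≤ D i) (hE0 : ∀ j, 0 ≤ E j)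
    (hD : Summable D) (hE : Summable E) {p : ι → κ → ℝ} (hp0 : ∀ i j, 0 ≤ p i j)
    (hrow : ∀ i (t : Finset κ), ∑ j ∈ t, p i j ≤ 1)
    (hcol : ∀ j (t : Finset ι), ∑ i ∈ t, p i j ≤ 1) (S : Finset (ι × κ)) :
    ∑ q ∈ S, p q.1 q.2 * (D q.1 + E q.2) ≤ ∑' i, D i + ∑' j, E j := by
  classical
  calc ∑ q ∈ S, p q.1 q.2 * (D q.1 + E q.2)
      ≤ ∑ q ∈ S.image Prod.fst ×ˢ S.image Prod.snd, p q.1 q.2 * (D q.1 + E q.2) :=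
        Finset.sum_le_sum_of_subset_of_nonneg Finset.subset_product fun q _ _ =>
          mul_nonneg (hp0 _ _) (add_nonneg (hD0 _) (hE0 _))
    _ = ∑ i ∈ S.image Prod.fst, (∑ j ∈ S.image Prod.snd, p i j) * D i +
          ∑ j ∈ S.image Prod.snd, (∑ i ∈ S.image Prod.fst, p i j) * E j := by
        simp only [mul_add, Finset.sum_add_distrib, Finset.sum_product, Finset.sum_mul]
        rw [Finset.sum_comm (f := fun i j => p i j * E j)]
    _ ≤ ∑ i ∈ S.image Prod.fst, D i + ∑ j ∈ S.image Prod.snd, E j :=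
        add_le_add
          (Finset.sum_le_sum fun i _ => mul_le_of_le_one_left (hD0 i) (hrow i _))
          (Finset.sum_le_sum fun j _ => mul_le_of_le_one_left (hE0 j) (hcol j _))
    _ ≤ _ := add_le_add (hD.sum_le_tsum _ fun i _ => hD0 i) (hE.sum_le_tsum _ fun j _ => hE0 j)

/-- The cross term of two square-summable families with weights dominated by a substochastic
`p` converges absolutely, since `|aᵢ bⱼ| ≤ |aᵢ|² + |bⱼ|²`. -/
theorem summable_substochastic {a : ι → ℂ} {b : κ → ℂ}
    (ha : Summable fun i => ‖a i‖ ^ 2) (hb : Summable fun j => ‖b j‖ ^ 2)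
    {p : ι → κ → ℝ} {γ : ι → κ → ℂ} (hγ : ∀ i j, ‖γ i j‖ ≤ p i j)
    (hrow : ∀ i (t : Finset κ), ∑ j ∈ t, p i j ≤ 1)
    (hcol : ∀ j (t : Finset ι), ∑ i ∈ t, p i j ≤ 1) :
    Summable fun q : ι × κ => star (a q.1) * b q.2 * γ q.1 q.2 := by
  have hp0 : ∀ i j, 0 ≤ p i j := fun i j => (norm_nonneg _).trans (hγ i j)
  have h1 : Summable fun q : ι × κ => p q.1 q.2 * (‖a q.1‖ ^ 2 + ‖b q.2‖ ^ 2) :=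
    summable_of_sum_le (fun q => mul_nonneg (hp0 _ _) (by positivity))
      (sum_substochastic_le (fun i => sq_nonneg ‖a i‖) (fun j => sq_nonneg ‖b j‖)
        ha hb hp0 hrow hcol)
  refine Summable.of_norm_bounded h1 fun q => ?_
  rw [norm_mul, norm_mul, norm_star, mul_comm]
  refine mul_le_mul (hγ _ _) ?_ (by positivity) (hp0 _ _)
  nlinarith [sq_nonneg (‖a q.1‖ - ‖b q.2‖), sq_nonneg (‖a q.1‖), sq_nonneg (‖b q.2‖)]

/-- The estimate `‖F - c G‖ ≤ L |s - c t|` for all unimodular `c` polarises: choosing `c` to align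
the cross terms bounds the modulus of `L² s t - F̄ G`. -/
theorem two_mul_norm_cross_le {L s t : ℝ} {F G : ℂ}
    (h : ∀ c : Circle, ‖F - c * G‖ ≤ L * ‖(s : ℂ) - c * t‖) :
    2 * ‖(L : ℂ) ^ 2 * s * t - star F * G‖ ≤
      (L ^ 2 * s ^ 2 - ‖F‖ ^ 2) + (L ^ 2 * t ^ 2 - ‖G‖ ^ 2) := by
  set z : ℂ := (L : ℂ) ^ 2 * s * t - star F * G with hz
  obtain ⟨c, hc⟩ : ∃ c : Circle, (c : ℂ) * z = ‖z‖ := by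
    refine ⟨Circle.exp (-z.arg), ?_⟩
    rw [Circle.coe_exp]
    conv_lhs => rw [← Complex.norm_mul_exp_arg_mul_I z]
    rw [mul_left_comm, ← Complex.exp_add]
    simp
  have h1 := pow_le_pow_left₀ (norm_nonneg _) (h c) 2
  rw [mul_pow, ← Complex.normSq_eq_norm_sq, ← Complex.normSq_eq_norm_sq, Complex.normSq_sub,
    Complex.normSq_sub, Complex.normSq_mul, Complex.normSq_mul] at h1
  have hcn : Complex.normSq (c : ℂ) = 1 := c.normSq_coe
  have h2 : (c * z).re = ‖z‖ := by rw [hc]; simp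
  have h3 : (F * (starRingEnd ℂ) (c * G)).re = (c * (star F * G)).re := by
    simp only [Complex.mul_re, Complex.mul_im, Complex.conj_re, Complex.conj_im,
      Complex.star_def]
    ring
  have h4 : ((s : ℂ) * (starRingEnd ℂ) (c * t)).re = (c * ((s : ℂ) * t)).re := by
    simp
    ring
  have h5 : (c * z).re = L ^ 2 * (c * ((s : ℂ) * t)).re - (c * (star F * G)).re := by
    rw [hz, mul_sub, Complex.sub_re, ← Complex.re_ofReal_mul]
    push_cast
    ring_nf
  rw [hcn, h3, h4] at h1
  rw [← Complex.normSq_eq_norm_sq, ← Complex.normSq_eq_norm_sq]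
  simp only [Complex.normSq_ofReal] at h1
  nlinarith

theorem norm_sq_le_of_lip {L s : ℝ} {F : ℂ} (h : ‖F‖ ≤ L * |s|) :
    0 ≤ L ^ 2 * s ^ 2 - ‖F‖ ^ 2 := by
  have := pow_le_pow_left₀ (norm_nonneg _) h 2
  rw [mul_pow, sq_abs] at this
  linarith

/-- The numerical inequality behind the operator estimate. Multiplying the polarised scalar
inequality by the weights `p i j` and summing costs nothing, since the weights have row and column
sums at most `1` and the diagonal defects `L² s² - |F|²` are nonnegative. -/
theorem sq_expansion_le {L : ℝ} {s : ι → ℝ} {t : κ → ℝ} {F : ι → ℂ} {G : κ → ℂ}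
    (hF : ∀ i, ‖F i‖ ≤ L * |s i|) (hG : ∀ j, ‖G j‖ ≤ L * |t j|)
    (hFG : ∀ i j (c : Circle), ‖F i - c * G j‖ ≤ L * ‖(s i : ℂ) - c * t j‖)
    (hs : Summable fun i => s i ^ 2) (ht : Summable fun j => t j ^ 2)
    {p : ι → κ → ℝ} {γ : ι → κ → ℂ} (hγ : ∀ i j, ‖γ i j‖ ≤ p i j)
    (hrow : ∀ i (t : Finset κ), ∑ j ∈ t, p i j ≤ 1)
    (hcol : ∀ j (t : Finset ι), ∑ i ∈ t, p i j ≤ 1) :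
    ∑' i, ‖F i‖ ^ 2 + ∑' j, ‖G j‖ ^ 2 -
        2 * (∑' q : ι × κ, star (F q.1) * G q.2 * γ q.1 q.2).re ≤
      L ^ 2 * (∑' i, ‖(s i : ℂ)‖ ^ 2 + ∑' j, ‖(t j : ℂ)‖ ^ 2 -
        2 * (∑' q : ι × κ, star (s q.1 : ℂ) * (t q.2 : ℂ) * γ q.1 q.2).re) := by
  have hp0 : ∀ i j, 0 ≤ p i j := fun i j => (norm_nonneg _).trans (hγ i j)
  have hD0 : ∀ i, 0 ≤ L ^ 2 * s i ^ 2 - ‖F i‖ ^ 2 := fun i => norm_sq_le_of_lip (hF i)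
  have hE0 : ∀ j, 0 ≤ L ^ 2 * t j ^ 2 - ‖G j‖ ^ 2 := fun j => norm_sq_le_of_lip (hG j)
  have hF2 : Summable fun i => ‖F i‖ ^ 2 :=
    Summable.of_nonneg_of_le (fun i => by positivity) (fun i => by linarith [hD0 i])
      (hs.mul_left (L ^ 2))
  have hG2 : Summable fun j => ‖G j‖ ^ 2 :=
    Summable.of_nonneg_of_le (fun j => by positivity) (fun j => by linarith [hE0 j])
      (ht.mul_left (L ^ 2))
  have hsn : ∀ i, ‖(s i : ℂ)‖ ^ 2 = s i ^ 2 := fun i => by simp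
  have htn : ∀ j, ‖(t j : ℂ)‖ ^ 2 = t j ^ 2 := fun j => by simp
  have h1 := summable_substochastic hF2 hG2 hγ hrow hcol
  have h2 := summable_substochastic (a := fun i => (s i : ℂ)) (b := fun j => (t j : ℂ))
    (by simpa only [hsn] using hs) (by simpa only [htn] using ht) hγ hrow hcol
  have h3 := Complex.hasSum_re ((h2.hasSum.mul_left ((L : ℂ) ^ 2)).sub h1.hasSum)
  have hDs := (hs.hasSum.mul_left (L ^ 2)).sub hF2.hasSum
  have hEs := (ht.hasSum.mul_left (L ^ 2)).sub hG2.hasSum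
  have h4 := hasSum_le_of_sum_le (h3.mul_left 2) fun S =>
    (Finset.sum_le_sum fun q _ => ?_).trans
      (sum_substochastic_le hD0 hE0 hDs.summable hEs.summable hp0 hrow hcol S)
  · rw [hDs.tsum_eq, hEs.tsum_eq, Complex.sub_re, ← Complex.ofReal_pow,
      Complex.re_ofReal_mul] at h4
    simp only [hsn, htn]
    linarith
  -- the termwise bound, weighted by `p`
  · have h5 := two_mul_norm_cross_le (hFG q.1 q.2)
    have h6 : (L : ℂ) ^ 2 * (star (s q.1 : ℂ) * (t q.2 : ℂ) * γ q.1 q.2) -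
        star (F q.1) * G q.2 * γ q.1 q.2 =
        ((L : ℂ) ^ 2 * s q.1 * t q.2 - star (F q.1) * G q.2) * γ q.1 q.2 := by
      have : star (s q.1 : ℂ) = s q.1 := Complex.conj_ofReal _
      rw [this]
      ring
    rw [h6]
    calc _ ≤ 2 * (‖(L : ℂ) ^ 2 * s q.1 * t q.2 - star (F q.1) * G q.2‖ * p q.1 q.2) := by
          gcongr
          refine (Complex.re_le_norm _).trans ?_
          rw [norm_mul]
          gcongr
          exact hγ _ _
      _ = p q.1 q.2 * (2 * ‖(L : ℂ) ^ 2 * s q.1 * t q.2 - star (F q.1) * G q.2‖) := by ring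
      _ ≤ _ := mul_le_mul_of_nonneg_left h5 (hp0 _ _)

end Numerical

/-! ### The Hilbert–Schmidt norm of a difference -/

section Expansion

variable {H : Type u} [NormedAddCommGroup H] [InnerProductSpace ℂ H]

theorem apply_right_of_hasSum {ι : Type v} {u v : ι → H} (hv : Orthonormal ℂ v) {a : ι → ℂ}
    {X : H →L[ℂ] H} (hX : ∀ h, HasSum (fun i => (a i * ⟪v i, h⟫_ℂ) • u i) (X h)) (i : ι) :
    X (v i) = a i • u i := by
  classical
  have h2 : HasSum (fun j => (a j * ⟪v j, v i⟫_ℂ) • u j) ((a i * ⟪v i, v i⟫_ℂ) • u i) := by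
    apply hasSum_single
    intro j hj
    rw [hv.2 hj]
    simp
  rw [(hX (v i)).unique h2]
  simp [hv.1 i]

variable [CompleteSpace H]

/-- Parseval's identity in `u` and then in `b`: the square sum of `∑ᵢ aᵢ uᵢ ⊗ vᵢ` over a Hilbert
basis is `∑ᵢ |aᵢ|²`. -/
theorem tsum_enorm_sq_of_hasSum {ι : Type v} {κ : Type w} {u v : ι → H} (hu : Orthonormal ℂ u)
    (hv : Orthonormal ℂ v) {a : ι → ℂ} {X : H →L[ℂ] H}
    (hX : ∀ h, HasSum (fun i => (a i * ⟪v i, h⟫_ℂ) • u i) (X h)) (b : HilbertBasis κ ℂ H) :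
    ∑' e, ‖X (b e)‖ₑ ^ 2 = ∑' i, ‖a i‖ₑ ^ 2 := by
  simp_rw [enorm_sq_of_hasSum hu (hX _)]
  rw [ENNReal.tsum_comm]
  refine tsum_congr fun i => ?_
  simp_rw [enorm_mul, mul_pow, enorm_inner_symm (v i)]
  rw [ENNReal.tsum_mul_left, ← enorm_sq_eq_tsum_inner b, ← ofReal_norm (v i), hv.1 i]
  simp

theorem hasSum_norm_sq_basis {ι : Type v} {κ : Type w} {u v : ι → H} (hu : Orthonormal ℂ u)
    (hv : Orthonormal ℂ v) {a : ι → ℂ} {X : H →L[ℂ] H}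
    (hX : ∀ h, HasSum (fun i => (a i * ⟪v i, h⟫_ℂ) • u i) (X h))
    (ha : Summable fun i => ‖a i‖ ^ 2) (b : HilbertBasis κ ℂ H) :
    HasSum (fun e => ‖X (b e)‖ ^ 2) (∑' i, ‖a i‖ ^ 2) := by
  have he : ∀ {G : Type u} [NormedAddCommGroup G] (x : G), ‖x‖ₑ ^ 2 = ENNReal.ofReal (‖x‖ ^ 2) :=
    fun x => by rw [ENNReal.ofReal_pow (norm_nonneg _), ofReal_norm]
  have hec : ∀ x : ℂ, ‖x‖ₑ ^ 2 = ENNReal.ofReal (‖x‖ ^ 2) :=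
    fun x => by rw [ENNReal.ofReal_pow (norm_nonneg _), ofReal_norm]
  have h1 := tsum_enorm_sq_of_hasSum hu hv hX b
  simp_rw [he, hec] at h1
  rw [← ENNReal.ofReal_tsum_of_nonneg (fun i => sq_nonneg _) ha] at h1
  have h2 := ENNReal.hasSum_toReal (h1.trans_ne ENNReal.ofReal_ne_top)
  rw [← ENNReal.tsum_toReal_eq (fun _ => ENNReal.ofReal_ne_top), h1,
    ENNReal.toReal_ofReal (tsum_nonneg fun i => sq_nonneg _)] at h2
  simpa only [ENNReal.toReal_ofReal (sq_nonneg _)] using h2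

/-- The Hilbert–Schmidt norm of the difference of `X = ∑ᵢ aᵢ uᵢ ⊗ vᵢ` and `Y = ∑ⱼ bⱼ wⱼ ⊗ zⱼ`. It is
computed in a Hilbert basis extending `v`: off the `vᵢ` the operator `X` vanishes, so the
cross term `⟨X, Y⟩` reduces to `∑ᵢ āᵢ ⟨uᵢ, Y vᵢ⟩`. -/
theorem hsENorm_sub_eq {ι : Type v} {κ : Type w} {u v : ι → H} {w z : κ → H}
    (hu : Orthonormal ℂ u) (hv : Orthonormal ℂ v) (hw : Orthonormal ℂ w) (hz : Orthonormal ℂ z)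
    {a : ι → ℂ} {b : κ → ℂ} {X Y : H →L[ℂ] H}
    (hX : ∀ h, HasSum (fun i => (a i * ⟪v i, h⟫_ℂ) • u i) (X h))
    (hY : ∀ h, HasSum (fun j => (b j * ⟪z j, h⟫_ℂ) • w j) (Y h))
    (ha : Summable fun i => ‖a i‖ ^ 2) (hb : Summable fun j => ‖b j‖ ^ 2)
    (hab : Summable fun q : ι × κ => star (a q.1) * b q.2 * (⟪u q.1, w q.2⟫_ℂ * ⟪z q.2, v q.1⟫_ℂ)) :
    hsENorm (X - Y) = ENNReal.ofReal (∑' i, ‖a i‖ ^ 2 + ∑' j, ‖b j‖ ^ 2 -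
      2 * (∑' q : ι × κ, star (a q.1) * b q.2 *
        (⟪u q.1, w q.2⟫_ℂ * ⟪z q.2, v q.1⟫_ℂ)).re) ^ (1 / 2 : ℝ) := by
  obtain ⟨W, e, hW, he⟩ := hv.toSubtypeRange.exists_hilbertBasis_extension
  have hcross : ∀ i, HasSum (fun j => star (a i) * b j * (⟪u i, w j⟫_ℂ * ⟪z j, v i⟫_ℂ))
      ⟪X (v i), Y (v i)⟫_ℂ := fun i => by
    have h1 := (hY (v i)).mapL (innerSL ℂ (X (v i)))
    rw [apply_right_of_hasSum hv hX] at h1 ⊢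
    refine h1.congr_fun fun j => ?_
    simp only [innerSL_apply_apply, inner_smul_left, inner_smul_right, Complex.star_def]
    ring
  have h1 : HasSum (fun i => ⟪X (v i), Y (v i)⟫_ℂ) _ := hab.hasSum.prod_fiberwise hcross
  -- re-index the `v i` inside the basis `W`; `X` vanishes on the remaining basis vectors
  let φ : ι → W := fun i => ⟨v i, hW ⟨i, rfl⟩⟩
  have hφ : Function.Injective φ := fun i j hij =>
    hv.linearIndependent.injective (congrArg Subtype.val hij)
  have hoff : ∀ x ∉ Set.range φ, X (e x) = 0 := fun x hx => by
    refine (hX (e x)).unique ?_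
    have : ∀ i, ⟪v i, e x⟫_ℂ = 0 := fun i => by
      have h2 : v i = e (φ i) := by rw [he]
      rw [h2]
      exact e.orthonormal.2 fun h => hx ⟨i, h⟩
    simp [this]
  have h2 : HasSum (fun x => ⟪X (e x), Y (e x)⟫_ℂ) _ := (hφ.hasSum_iff (fun x hx => by
    rw [hoff x hx, inner_zero_left])).1 (by simpa only [Function.comp_def, he, φ] using h1)
  have h3 : HasSum (fun x => ‖(X - Y) (e x)‖ ^ 2) _ :=
    (((hasSum_norm_sq_basis hu hv hX ha e).add (hasSum_norm_sq_basis hw hz hY hb e)).sub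
      ((Complex.hasSum_re h2).mul_left 2)).congr_fun fun x => by
    rw [sub_apply, @norm_sub_sq ℂ]
    simp only [RCLike.re_to_complex]
    ring
  rw [hsENorm_eq e, ← h3.tsum_eq, ENNReal.ofReal_tsum_of_nonneg (fun x => sq_nonneg _) h3.summable]
  congr 2
  ext x
  rw [ENNReal.ofReal_pow (norm_nonneg _), ofReal_norm]

end Expansion

/-! ### The Lipschitz estimate -/

section Estimate

variable {f : ℝ≥0 → ℂ}

/-- A `K`-Lipschitz `f` with `f 0 = 0` has `‖f‖_{Lip-ℂ} ≤ 3 K`: split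
`f x - c f y = (f x - f y) + (1 - c) f y` and use `|x - y| ≤ |x - c y|` and
`|1 - c| y ≤ |x - y| + |x - c y|`. -/
theorem norm_sub_mul_le_of_lipschitz {K : ℝ≥0} (hf : LipschitzWith K f) (hf0 : f 0 = 0)
    (x y : ℝ≥0) (c : Circle) :
    ‖f x - c * f y‖ ≤ 3 * K * ‖((x : ℝ) : ℂ) - c * ((y : ℝ) : ℂ)‖ := by
  have h1 : ‖f x - f y‖ ≤ K * |(x : ℝ) - y| := by
    simpa [dist_eq_norm, NNReal.dist_eq] using hf.dist_le_mul x y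
  have h2 : ‖f y‖ ≤ K * y := by
    simpa [dist_eq_norm, NNReal.dist_eq, hf0] using hf.dist_le_mul y 0
  have h3 : |(x : ℝ) - y| ≤ ‖((x : ℝ) : ℂ) - c * ((y : ℝ) : ℂ)‖ := by
    have := abs_norm_sub_norm_le ((x : ℝ) : ℂ) (c * ((y : ℝ) : ℂ))
    simpa [Circle.norm_coe] using this
  have h4 : ‖(1 : ℂ) - c‖ * y ≤ 2 * ‖((x : ℝ) : ℂ) - c * ((y : ℝ) : ℂ)‖ := by
    have h5 : ‖(1 : ℂ) - c‖ * y = ‖((1 : ℂ) - c) * ((y : ℝ) : ℂ)‖ := by simp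
    have h6 : ((1 : ℂ) - c) * ((y : ℝ) : ℂ) =
        (((x : ℝ) : ℂ) - c * ((y : ℝ) : ℂ)) - (((x - y : ℝ)) : ℂ) := by push_cast; ring
    rw [h5, h6]
    refine (norm_sub_le _ _).trans ?_
    rw [Complex.norm_real, Real.norm_eq_abs]
    linarith
  calc ‖f x - c * f y‖ = ‖(f x - f y) + (1 - c) * f y‖ := by ring_nf
    _ ≤ ‖f x - f y‖ + ‖(1 : ℂ) - c‖ * ‖f y‖ := (norm_add_le _ _).trans (by rw [norm_mul])
    _ ≤ K * |(x : ℝ) - y| + ‖(1 : ℂ) - c‖ * (K * y) := by gcongr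
    _ = K * (|(x : ℝ) - y| + ‖(1 : ℂ) - c‖ * y) := by ring
    _ ≤ K * (‖((x : ℝ) : ℂ) - c * ((y : ℝ) : ℂ)‖ +
          2 * ‖((x : ℝ) : ℂ) - c * ((y : ℝ) : ℂ)‖) := by gcongr
    _ = _ := by ring

theorem lipC_lt_top {K : ℝ≥0} (hf : LipschitzWith K f) (hf0 : f 0 = 0) : lipC f < ⊤ := by
  refine lt_of_le_of_lt (b := ENNReal.ofReal (3 * K)) ?_ ENNReal.ofReal_lt_top
  refine iSup_le fun x => iSup_le fun y => iSup_le fun c => iSup_le fun _ =>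
    ENNReal.div_le_of_le_mul ?_
  rw [← ofReal_norm, ← ofReal_norm, ← ENNReal.ofReal_mul (by positivity)]
  exact ENNReal.ofReal_le_ofReal (norm_sub_mul_le_of_lipschitz hf hf0 x y c)

/-- The defining inequality of `‖f‖_{Lip-ℂ}`, including the degenerate case `x = c y`, where either
`x = y = 0` or `c = 1`. -/
theorem norm_sub_mul_le_lipC (hf0 : f 0 = 0) (hL : lipC f < ⊤) (x y : ℝ≥0) (c : Circle) :
    ‖f x - c * f y‖ ≤ (lipC f).toReal * ‖((x : ℝ) : ℂ) - c * ((y : ℝ) : ℂ)‖ := by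
  by_cases h : ((x : ℝ) : ℂ) = (c : ℂ) * ((y : ℝ) : ℂ)
  · have hxy : x = y := by
      have := congrArg norm h
      simpa [Circle.norm_coe] using this
    subst hxy
    by_cases hx : x = 0
    · simp [hx, hf0]
    · have hc : (c : ℂ) = 1 := by
        have hx' : ((x : ℝ) : ℂ) ≠ 0 := by exact_mod_cast hx
        exact mul_right_cancel₀ hx' (by rw [← h, one_mul])
      simp [hc]
  · have h1 : ‖f x - c * f y‖ₑ / ‖((x : ℝ) : ℂ) - c * ((y : ℝ) : ℂ)‖ₑ ≤ lipC f :=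
      le_iSup_of_le x (le_iSup_of_le y (le_iSup_of_le c (le_iSup_of_le h le_rfl)))
    rw [ENNReal.div_le_iff (by simpa [sub_eq_zero] using h) (by simp)] at h1
    have h2 := ENNReal.toReal_mono (ENNReal.mul_ne_top hL.ne (by simp)) h1
    rw [ENNReal.toReal_mul] at h2
    simpa using h2

theorem norm_le_lipC (hf0 : f 0 = 0) (hL : lipC f < ⊤) (x : ℝ≥0) :
    ‖f x‖ ≤ (lipC f).toReal * |(x : ℝ)| := by
  simpa [hf0] using norm_sub_mul_le_lipC hf0 hL x 0 1

variable {H : Type u} [NormedAddCommGroup H] [InnerProductSpace ℂ H] [CompleteSpace H]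

theorem IsSVD.summable_sq {ι : Type v} {A : H →L[ℂ] H} {s : ι → ℝ≥0} {u v : ι → H}
    (hA : IsSVD A s u v) (h : hsENorm A < ⊤) : Summable fun i => (s i : ℝ) ^ 2 := by
  rw [hA.hsENorm_eq] at h
  have h1 : ∑' i, (s i : ℝ≥0∞) ^ 2 ≠ ⊤ := fun h2 => by
    rw [h2, ENNReal.top_rpow_of_pos (by norm_num)] at h
    exact lt_irrefl _ h
  simpa using ENNReal.summable_toReal h1

theorem exists_isSingularCalculus_of_lipC_lt_top (hf0 : f 0 = 0) (hL : lipC f < ⊤)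
    {A : H →L[ℂ] H} (hA : IsCompactOperator A) : ∃ T, IsSingularCalculus f A T :=
  exists_isSingularCalculus (K := (lipC f).toNNReal)
    (fun x => (norm_le_lipC hf0 hL x).trans_eq (by rw [NNReal.abs_eq]; rfl)) hA

omit [CompleteSpace H] in
theorem sum_overlap_le_one {κ : Type w} {w z : κ → H} (hw : Orthonormal ℂ w)
    (hz : Orthonormal ℂ z) {x y : H} (hx : ‖x‖ = 1) (hy : ‖y‖ = 1) (S : Finset κ) :
    ∑ j ∈ S, (‖⟪w j, x⟫_ℂ‖ ^ 2 + ‖⟪z j, y⟫_ℂ‖ ^ 2) / 2 ≤ 1 := by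
  have h1 := hw.sum_inner_products_le x (s := S)
  have h2 := hz.sum_inner_products_le y (s := S)
  rw [hx] at h1
  rw [hy] at h2
  rw [← Finset.sum_div, Finset.sum_add_distrib]
  linarith

omit [CompleteSpace H] in
theorem norm_overlap_le (u v w z : H) :
    ‖⟪u, w⟫_ℂ * ⟪z, v⟫_ℂ‖ ≤ (‖⟪u, w⟫_ℂ‖ ^ 2 + ‖⟪v, z⟫_ℂ‖ ^ 2) / 2 := by
  rw [norm_mul, norm_inner_symm z]
  nlinarith [sq_nonneg (‖⟪u, w⟫_ℂ‖ - ‖⟪v, z⟫_ℂ‖)]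

theorem summable_norm_sq_of_lipC (hf0 : f 0 = 0) (hL : lipC f < ⊤) {ι : Type v} {s : ι → ℝ≥0}
    (h : Summable fun i => (s i : ℝ) ^ 2) : Summable fun i => ‖f (s i)‖ ^ 2 :=
  Summable.of_nonneg_of_le (fun _ => sq_nonneg _)
    (fun i => by linarith [norm_sq_le_of_lip (norm_le_lipC hf0 hL (s i))])
    (h.mul_left ((lipC f).toReal ^ 2))

/-- The Lipschitz estimate in the Hilbert–Schmidt norm with constant `‖f‖_{Lip-ℂ}`. Both sides are
expanded over the same singular value decompositions and compared by `sq_expansion_le`. -/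
theorem hsENorm_singularCalculus_sub_le (hf0 : f 0 = 0) (hL : lipC f < ⊤) {A B : H →L[ℂ] H}
    (hA : IsHilbertSchmidt A) (hB : IsHilbertSchmidt B) :
    hsENorm (singularCalculus f A - singularCalculus f B) ≤ lipC f * hsENorm (A - B) := by
  obtain ⟨ι, s, u, v, hA1, hA2⟩ := isSingularCalculus_singularCalculus
    (exists_isSingularCalculus_of_lipC_lt_top hf0 hL hA.1)
  obtain ⟨κ, t, w, z, hB1, hB2⟩ := isSingularCalculus_singularCalculus
    (exists_isSingularCalculus_of_lipC_lt_top hf0 hL hB.1)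
  have hs := hA1.summable_sq hA.2
  have ht := hB1.summable_sq hB.2
  have hs' : Summable fun i => ‖((s i : ℝ) : ℂ)‖ ^ 2 := by simpa using hs
  have ht' : Summable fun j => ‖((t j : ℝ) : ℂ)‖ ^ 2 := by simpa using ht
  have hfs := summable_norm_sq_of_lipC hf0 hL hs
  have hft := summable_norm_sq_of_lipC hf0 hL ht
  have hγ := fun i j => norm_overlap_le (u i) (v i) (w j) (z j)
  -- the row and column sums of the weights are controlled by Bessel's inequality
  have hrow : ∀ i (S : Finset κ),
      ∑ j ∈ S, (‖⟪u i, w j⟫_ℂ‖ ^ 2 + ‖⟪v i, z j⟫_ℂ‖ ^ 2) / 2 ≤ 1 := fun i S => by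
    simp only [norm_inner_symm (u i), norm_inner_symm (v i)]
    exact sum_overlap_le_one hB1.1 hB1.2 (hA1.1.1 i) (hA1.2.1 i) S
  have hcol : ∀ j (S : Finset ι),
      ∑ i ∈ S, (‖⟪u i, w j⟫_ℂ‖ ^ 2 + ‖⟪v i, z j⟫_ℂ‖ ^ 2) / 2 ≤ 1 := fun j S =>
    sum_overlap_le_one hA1.1 hA1.2 (hB1.1.1 j) (hB1.2.1 j) S
  have key := sq_expansion_le (fun i => norm_le_lipC hf0 hL (s i))
    (fun j => norm_le_lipC hf0 hL (t j))
    (fun i j c => norm_sub_mul_le_lipC hf0 hL (s i) (t j) c) hs ht hγ hrow hcol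
  have hsumf := summable_substochastic hfs hft hγ hrow hcol
  have hsum := summable_substochastic hs' ht' hγ hrow hcol
  rw [hsENorm_sub_eq hA1.1 hA1.2 hB1.1 hB1.2 hA2 hB2 hfs hft hsumf,
    hsENorm_sub_eq hA1.1 hA1.2 hB1.1 hB1.2 hA1.3 hB1.3 hs' ht' hsum]
  refine (ENNReal.rpow_le_rpow (ENNReal.ofReal_le_ofReal key) (by norm_num)).trans_eq ?_
  rw [ENNReal.ofReal_mul (sq_nonneg _), ENNReal.mul_rpow_of_nonneg _ _ (by norm_num),
    ENNReal.ofReal_pow ENNReal.toReal_nonneg, ENNReal.ofReal_toReal hL.ne, ← ENNReal.rpow_natCast,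
    ← ENNReal.rpow_mul]
  norm_num

theorem operatorLip_le (hf0 : f 0 = 0) (hL : lipC f < ⊤) : operatorLip H f ≤ lipC f :=
  iSup_le fun _ => iSup_le fun _ => iSup_le fun hA => iSup_le fun hB => iSup_le fun _ =>
    ENNReal.div_le_of_le_mul (hsENorm_singularCalculus_sub_le hf0 hL hA hB)

end Estimate

/-! ### Sharpness on rank-one operators -/

section Sharpness

open InnerProductSpace

variable {f : ℝ≥0 → ℂ} {H : Type u} [NormedAddCommGroup H] [InnerProductSpace ℂ H]

theorem hasSum_smul_rankOne (e : H) (a c : ℂ) (h : H) :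
    HasSum (fun _ : PUnit.{u + 1} => (a * ⟪e, h⟫_ℂ) • c • e) (((c * a) • rankOne ℂ e e) h) := by
  have := hasSum_fintype (fun _ : PUnit.{u + 1} => (a * ⟪e, h⟫_ℂ) • c • e)
  convert this using 1
  simp only [smul_apply, rankOne_apply, smul_smul, Finset.univ_unique,
    Finset.sum_singleton]
  congr 1
  ring

theorem orthonormal_punit {e : H} (he : ‖e‖ = 1) : Orthonormal ℂ fun _ : PUnit.{u + 1} => e :=
  ⟨fun _ => he, fun i j hij => (hij (Subsingleton.elim i j)).elim⟩

theorem isCompactOperator_smul_rankOne (e : H) (a : ℂ) :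
    IsCompactOperator (a • rankOne ℂ e e : H →L[ℂ] H) := by
  have h : IsCompactOperator ((1 : ℂ →L[ℂ] ℂ) ∘L innerSL ℂ e : H →L[ℂ] ℂ) :=
    (isCompactOperator_of_locallyCompactSpace_rng (1 : ℂ →L[ℂ] ℂ)).comp_clm (innerSL ℂ e)
  have h2 : (a • rankOne ℂ e e : H →L[ℂ] H) = (a • ContinuousLinearMap.toSpanSingleton ℂ e) ∘L
      ((1 : ℂ →L[ℂ] ℂ) ∘L innerSL ℂ e) := by
    ext x
    simp
  rw [h2]
  exact h.clm_comp (a • ContinuousLinearMap.toSpanSingleton ℂ e)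

variable [CompleteSpace H]

theorem hsENorm_smul_rankOne {e : H} (he : ‖e‖ = 1) (a : ℂ) :
    hsENorm (a • rankOne ℂ e e : H →L[ℂ] H) = ‖a‖ₑ := by
  obtain ⟨W, b, -⟩ := exists_hilbertBasis ℂ H
  have h := tsum_enorm_sq_of_hasSum (orthonormal_punit he) (orthonormal_punit he)
    (a := fun _ => a) (X := a • rankOne ℂ e e) (fun h => by simpa using hasSum_smul_rankOne e a 1 h)
    b
  rw [hsENorm_eq b, h, tsum_fintype, Finset.univ_unique, Finset.sum_singleton,
    ← ENNReal.rpow_natCast, ← ENNReal.rpow_mul]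
  norm_num

theorem isHilbertSchmidt_smul_rankOne {e : H} (he : ‖e‖ = 1) (a : ℂ) :
    IsHilbertSchmidt (a • rankOne ℂ e e : H →L[ℂ] H) :=
  ⟨isCompactOperator_smul_rankOne e a, by rw [hsENorm_smul_rankOne he]; exact enorm_lt_top⟩

theorem singularCalculus_smul_rankOne (hf0 : f 0 = 0) {e : H} (he : ‖e‖ = 1) (c : Circle)
    (x : ℝ≥0) :
    singularCalculus f (((c : ℂ) * ((x : ℝ) : ℂ)) • rankOne ℂ e e : H →L[ℂ] H) =
      ((c : ℂ) * f x) • rankOne ℂ e e := by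
  refine IsSingularCalculus.eq_singularCalculus hf0 ⟨PUnit.{u + 1}, fun _ => x,
    fun _ => (c : ℂ) • e, fun _ => e, ⟨orthonormal_punit ?_, orthonormal_punit he, ?_⟩, ?_⟩
  · rw [norm_smul, Circle.norm_coe, he, one_mul]
  · exact hasSum_smul_rankOne e _ _
  · exact hasSum_smul_rankOne e _ _

/-- Each difference quotient of `f` is attained by multiples of a rank-one projection. -/
theorem lipC_le_operatorLip [Nontrivial H] (hf0 : f 0 = 0) : lipC f ≤ operatorLip H f := by
  obtain ⟨e, he⟩ := exists_norm_eq H (zero_le_one' ℝ)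
  refine iSup_le fun x => iSup_le fun y => iSup_le fun c => iSup_le fun h => ?_
  have hx := singularCalculus_smul_rankOne hf0 he 1 x
  have hy := singularCalculus_smul_rankOne hf0 he c y
  simp only [Circle.coe_one, one_mul] at hx
  have hd := hsENorm_smul_rankOne he (((x : ℝ) : ℂ) - c * ((y : ℝ) : ℂ))
  have hfd := hsENorm_smul_rankOne he (f x - c * f y)
  rw [sub_smul] at hd hfd
  rw [← hfd, ← hd, ← hx, ← hy]
  refine le_iSup_of_le _ (le_iSup_of_le _ (le_iSup_of_le (isHilbertSchmidt_smul_rankOne he _)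
    (le_iSup_of_le (isHilbertSchmidt_smul_rankOne he _) (le_iSup_of_le ?_ le_rfl))))
  intro h1
  rw [h1, sub_self] at hd
  have h0 : hsENorm (0 : H →L[ℂ] H) = 0 := by
    simpa using hsENorm_smul_rankOne he 0
  rw [h0, eq_comm, enorm_eq_zero, sub_eq_zero] at hd
  exact h hd

end Sharpness

/-! ### Matrices -/

section Matrices

open scoped Matrix.Norms.Frobenius

variable {d : ℕ}

theorem enorm_eq_hsENorm_toEuclideanCLM (A : Matrix (Fin d) (Fin d) ℂ) :
    ‖A‖ₑ = hsENorm (Matrix.toEuclideanCLM (n := Fin d) (𝕜 := ℂ) A) := by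
  rw [hsENorm_eq (EuclideanSpace.basisFun (Fin d) ℂ).toHilbertBasis, tsum_fintype,
    enorm_eq_nnnorm, Matrix.frobenius_nnnorm_def, Finset.sum_comm,
    ENNReal.coe_rpow_of_nonneg _ (by norm_num)]
  congr 1
  push_cast
  refine Finset.sum_congr rfl fun j _ => ?_
  rw [OrthonormalBasis.coe_toHilbertBasis, EuclideanSpace.basisFun_apply, enorm_eq_nnnorm,
    ← ENNReal.coe_pow, EuclideanSpace.nnnorm_eq, NNReal.sq_sqrt]
  push_cast
  refine Finset.sum_congr rfl fun i _ => ?_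
  rw [Matrix.ofLp_toEuclideanCLM]
  simp

theorem matrixLip_eq_operatorLip (d : ℕ) (f : ℝ≥0 → ℂ) :
    matrixLip d f = operatorLip (EuclideanSpace ℂ (Fin d)) f := by
  let φ := Matrix.toEuclideanCLM (n := Fin d) (𝕜 := ℂ)
  have hHS : ∀ T : EuclideanSpace ℂ (Fin d) →L[ℂ] EuclideanSpace ℂ (Fin d), IsHilbertSchmidt T :=
    fun T => ⟨isCompactOperator_of_locallyCompactSpace_rng T, by
      have := enorm_eq_hsENorm_toEuclideanCLM (φ.symm T)
      rw [show Matrix.toEuclideanCLM (n := Fin d) (𝕜 := ℂ) (φ.symm T) = T from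
        φ.apply_symm_apply T] at this
      rw [← this]
      exact enorm_lt_top⟩
  have hq : ∀ A B, ‖matrixCalculus f A - matrixCalculus f B‖ₑ / ‖A - B‖ₑ =
      hsENorm (singularCalculus f (φ A) - singularCalculus f (φ B)) / hsENorm (φ A - φ B) :=
    fun A B => by
      rw [enorm_eq_hsENorm_toEuclideanCLM, enorm_eq_hsENorm_toEuclideanCLM, map_sub, map_sub,
        matrixCalculus, matrixCalculus]
      simp [φ]
  unfold matrixLip operatorLip
  refine Function.Surjective.iSup_congr φ φ.surjective fun A =>
    (Function.Surjective.iSup_congr φ φ.surjective fun B => ?_).symm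
  simp only [hq, hHS, iSup_pos, ne_eq, EmbeddingLike.apply_eq_iff_eq]

end Matrices
end SingularCalculus

theorem mainTheorem2 (f : ℝ≥0 → ℂ) (hf : ∃ K : ℝ≥0, LipschitzWith K f) (hf0 : f 0 = 0) :
    SingularCalculus.lipC f < ⊤ ∧
    (∀ (H : Type u) [NormedAddCommGroup H] [InnerProductSpace ℂ H] [CompleteSpace H]
      [TopologicalSpace.SeparableSpace H] [Nontrivial H],
      (∀ A : H →L[ℂ] H, IsCompactOperator A →
        SingularCalculus.IsSingularCalculus f A (SingularCalculus.singularCalculus f A)) ∧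
      (∀ A B : H →L[ℂ] H,
        SingularCalculus.IsHilbertSchmidt A → SingularCalculus.IsHilbertSchmidt B →
        SingularCalculus.hsENorm
            (SingularCalculus.singularCalculus f A - SingularCalculus.singularCalculus f B) ≤
          SingularCalculus.lipC f * SingularCalculus.hsENorm (A - B)) ∧
      (∀ C : ℝ≥0∞,
        (∀ A B : H →L[ℂ] H,
          SingularCalculus.IsHilbertSchmidt A → SingularCalculus.IsHilbertSchmidt B →
          SingularCalculus.hsENorm
              (SingularCalculus.singularCalculus f A - SingularCalculus.singularCalculus f B) ≤
            C * SingularCalculus.hsENorm (A - B)) →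
        SingularCalculus.lipC f ≤ C) ∧
      SingularCalculus.operatorLip H f = SingularCalculus.lipC f) ∧
    ∀ d : ℕ, 1 ≤ d → SingularCalculus.matrixLip d f = SingularCalculus.lipC f := by
  obtain ⟨K, hK⟩ := hf
  have hL := SingularCalculus.lipC_lt_top hK hf0
  refine ⟨hL, fun H _ _ _ _ _ => ⟨fun A hA => ?_, fun A B hA hB => ?_, fun C hC => ?_, ?_⟩,
    fun d hd => ?_⟩
  · exact SingularCalculus.isSingularCalculus_singularCalculus
      (SingularCalculus.exists_isSingularCalculus_of_lipC_lt_top hf0 hL hA)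
  · exact SingularCalculus.hsENorm_singularCalculus_sub_le hf0 hL hA hB
  · exact (SingularCalculus.lipC_le_operatorLip (H := H) hf0).trans <|
      iSup_le fun A => iSup_le fun B => iSup_le fun hA => iSup_le fun hB => iSup_le fun _ =>
        ENNReal.div_le_of_le_mul (hC A B hA hB)
  · exact (SingularCalculus.operatorLip_le hf0 hL).antisymm
      (SingularCalculus.lipC_le_operatorLip hf0)
  · have : Nonempty (Fin d) := ⟨⟨0, hd⟩⟩
    rw [SingularCalculus.matrixLip_eq_operatorLip]
    exact (SingularCalculus.operatorLip_le hf0 hL).antisymm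
      (SingularCalculus.lipC_le_operatorLip hf0)
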